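/- Let $m\ge 2$ be an integer. Let $P_{-2,k}(c)$, $k\ge -4$, be the polynomials in $c$ determined by $P_{-2,-4}=P_{-2,-3}=P_{-2,-1}=0$, $P_{-2,-2}=1$ and, for $k\ge 0$, $$(km+m+4)\,P_{-2,k}(c)=2c\,((k-1)m+2)\,P_{-2,k-2}(c)-(k-3)m\,P_{-2,k-4}(c),$$ and let $P_{-2}(c,z)=\sum_{n\ge 0}P_{-2,n-4}(c)\,z^{n}$ be their generating function. Then the following hold. 1. The series converges for all $c\in[-1,1]$ and $z\in(-1,1)$, and for $c\in[-1,1]$, $z\in(0,1)$ its sum is the superelliptic integral $$P_{-2}(c,z)=z^{3-4/m}(1-2cz^2+z^4)^{1/m}\lim_{\epsilon\to0^+}\left[\int_\epsilon^z\frac{4-m}{m\,w^{2-4/m}(1-2cw^2+w^4)^{1+1/m}}\,dw+\epsilon^{4/m-1}\right],$$ where the limit exists. 2. $P_{-2}$ is $C^\infty$ on $(-1,1)\times(-1,1)$ and, with $v=\ln z$, $\frac{\partial}{\partial v}=z\frac{\partial}{\partial z}$, it satisfies for all $(c,z)\in(-1,1)\times(0,1)$ the fourth-order linear PDE $$0=m^2\left[4(1-c^2)\frac{\partial^2}{\partial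 c^2}-12c\frac{\partial}{\partial c}+\frac{\partial^2}{\partial v^2}+2\left(\frac2m-3\right)\frac{\partial}{\partial v}-4\right]^2P_{-2}+(144m^2-256m)\frac{\partial^2P_{-2}}{\partial c^2}-16(3m-2)^2\left(c\frac{\partial}{\partial c}+1\right)^2P_{-2}.$$ 3. For all $c\in[-1,1]$, $$\frac{\partial^2P_{-2}}{\partial z^2}(c,0)=2,\qquad P_{-2}(c,0)=\frac{\partial P_{-2}}{\partial z}(c,0)=\frac{\partial^3P_{-2}}{\partial z^3}(c,0)=0.$$ -/

import Mathlib

open Set Filter Topology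
open scoped ContDiff

namespace Superelliptic

noncomputable section

/-- The second polynomial family attached to `u ^ m = 1 - 2 c t ^ 2 + t ^ 4`, with the index shifted
by four: `poly2 m n` is `P_{-2, n - 4}(c)`. The initial values are `P_{-4} = P_{-3} = P_{-1} = 0`,
`P_{-2} = 1`, and for `k ≥ 0`
`(k m + m + 4) P_k = 2 c ((k - 1) m + 2) P_{k-2} - (k - 3) m P_{k-4}`
(see `poly2_recursion`). -/
def poly2 (m : ℕ) : ℕ → Polynomial ℝ
  | 0 => 0
  | 1 => 0
  | 2 => 1
  | 3 => 0
  | k + 4 =>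
      Polynomial.C ((k : ℝ) * m + m + 4)⁻¹ *
        (Polynomial.C (2 * (((k : ℝ) - 1) * m + 2)) * Polynomial.X * poly2 m (k + 2)
          - Polynomial.C (((k : ℝ) - 3) * m) * poly2 m k)

theorem poly2_recursion (m k : ℕ) :
    Polynomial.C ((k : ℝ) * m + m + 4) * poly2 m (k + 4) =
      Polynomial.C (2 * (((k : ℝ) - 1) * m + 2)) * Polynomial.X * poly2 m (k + 2)
        - Polynomial.C (((k : ℝ) - 3) * m) * poly2 m k := by
  have h : (k : ℝ) * m + m + 4 ≠ 0 := by positivity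
  rw [poly2, ← mul_assoc, ← Polynomial.C_mul, mul_inv_cancel₀ h, Polynomial.C_1, one_mul]

/-- The generating function `P_{-2}(c, z) = ∑_{n ≥ 0} P_{-2, n - 4}(c) z ^ n`. -/
def genFun2 (m : ℕ) (c z : ℝ) : ℝ := ∑' n : ℕ, (poly2 m n).eval c * z ^ n

/-- The quantity `1 - 2 c z ^ 2 + z ^ 4`. -/
def quartic (c z : ℝ) : ℝ := 1 - 2 * c * z ^ 2 + z ^ 4

/-- The regularised superelliptic integral
`∫_ε^z (4 - m) / (m w ^ (2 - 4 / m) (1 - 2 c w ^ 2 + w ^ 4) ^ (1 + 1 / m)) dw + ε ^ (4 / m - 1)`. -/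
def regIntegral2 (m : ℕ) (c z ε : ℝ) : ℝ :=
  (∫ w in ε..z, (4 - (m : ℝ)) /
      ((m : ℝ) * w ^ (2 - 4 / (m : ℝ)) * quartic c w ^ (1 + 1 / (m : ℝ))))
    + ε ^ (4 / (m : ℝ) - 1)

/-- The partial derivative `∂/∂c`. -/
def dc (f : ℝ → ℝ → ℝ) : ℝ → ℝ → ℝ := fun c z => deriv (fun x => f x z) c

/-- The partial derivative `∂/∂v = z ∂/∂z`, where `v = ln z`. -/
def dv (f : ℝ → ℝ → ℝ) : ℝ → ℝ → ℝ := fun c z => z * deriv (fun y => f c y) z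

/-- The operator
`4 (1 - c ^ 2) ∂²/∂c² - 12 c ∂/∂c + ∂²/∂v² + 2 (2 / m - 3) ∂/∂v - 4`. -/
def opL (m : ℕ) (f : ℝ → ℝ → ℝ) : ℝ → ℝ → ℝ := fun c z =>
  4 * (1 - c ^ 2) * dc (dc f) c z - 12 * c * dc f c z + dv (dv f) c z
    + 2 * (2 / (m : ℝ) - 3) * dv f c z - 4 * f c z

/-- The operator `c ∂/∂c + 1`. -/
def opE (f : ℝ → ℝ → ℝ) : ℝ → ℝ → ℝ := fun c z => c * dc f c z + f c z

end

end Superelliptic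

/-!
The generating function is treated as a power series in `z` with polynomial coefficients in `c`.

*Convergence and smoothness.* After division by its leading coefficient the recursion is a
perturbation of `x (n + 4) = 2 c x (n + 2) - x n`, whose characteristic roots have modulus one for
`c ∈ [-1, 1]`. Hence solutions grow subexponentially, uniformly in `c`
(`exists_bound_of_recurrence`). The `c`-derivatives of the coefficients satisfy the same recursion
with a source term of lower order, so they grow subexponentially too (`moderate_poly2`). This
permits termwise differentiation to any order (`Moderate.contDiffOn_polySeries`), and the values
at `z = 0` are read off from the first coefficients.

*The integral.* Summing the recursion gives a first-order linear equation in `z`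
(`genFun2_first_order`), whose homogeneous solution is `z ^ (3 - 4 / m) * quartic c z ^ (1 / m)`.
The quotient by this solution is a primitive of the superelliptic integrand
(`hasDerivAt_quotient`). Near `0` it equals `ε ^ (4 / m - 1) + o(1)`, because the generating
function starts with `z ^ 2` (`tendsto_quotient_sub`), which gives the limit of the regularised
integral.

*The partial differential equation.* By termwise differentiation it is equivalent to a
fourth-order ordinary differential equation in `c` for each coefficient (`poly2_fourth_order`).
With `n = 2 j` the recursion is the Gegenbauer recurrence of order `-1 / m` in the shifted degree
`j + 2 / m - 3 / 2`, and the coefficients form one of its two fundamental solutions. Gegenbauer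
functions have first-order ladder relations in `c`; applied at both ends of the recurrence, these
express the derivatives of the fundamental solutions `a` and `d` through `a j`, `a (j + 1)`, `d j`
and `d (j + 1)` (`gegenbauerSeq_ladder`). Eliminating the other three leaves an equation of order
four for `a j` (`ladder_fourth_order`).
-/

namespace Superelliptic

open Polynomial

/-! ### Growth of solutions of perturbed recurrences -/

/-- Sequences whose two-step growth factors tend to a limit less than one have a common upper
bound, as soon as their first two terms do. -/
theorem exists_bound_of_two_step {ι : Type*} {N : ι → ℕ → ℝ} {q : ℕ → ℝ} {q₀ S B₀ B₁ : ℝ}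
    (hq : Tendsto q atTop (𝓝 q₀)) (hq₀ : q₀ < 1) (hq0 : ∀ n, 0 ≤ q n)
    (h₀ : ∀ i, N i 0 ≤ B₀) (h₁ : ∀ i, N i 1 ≤ B₁)
    (hN : ∀ i n, N i (n + 2) ≤ q n * N i n + S) : ∃ C, ∀ i n, N i n ≤ C := by
  have hB : ∀ n, ∃ B, ∀ i, N i n ≤ B := by
    intro n
    induction n using Nat.twoStepInduction with
    | zero => exact ⟨B₀, h₀⟩
    | one => exact ⟨B₁, h₁⟩
    | more n ih _ =>
      obtain ⟨B, hB⟩ := ih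
      exact ⟨q n * B + S, fun i ↦ (hN i n).trans (by gcongr; exacts [hq0 n, hB i])⟩
  choose B hB using hB
  obtain ⟨ρ, hρ₁, hρ₂⟩ := exists_between hq₀
  obtain ⟨n₀, hn₀⟩ := eventually_atTop.1 (hq.eventually_le_const hρ₁)
  have hρ0 : 0 ≤ ρ := (hq0 n₀).trans (hn₀ n₀ le_rfl)
  set K : ℝ := |S| / (1 - ρ) + ∑ k ∈ Finset.range (n₀ + 2), |B k| with hK
  have hpos : 0 < 1 - ρ := by linarith
  have hsum : 0 ≤ ∑ k ∈ Finset.range (n₀ + 2), |B k| := Finset.sum_nonneg fun _ _ ↦ abs_nonneg _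
  have hSK : S ≤ (1 - ρ) * K := by
    rw [hK, mul_add, mul_div_cancel₀ _ hpos.ne']
    have := mul_nonneg hpos.le hsum
    linarith [le_abs_self S]
  have hK0 : 0 ≤ K := by positivity
  refine ⟨K, fun i n ↦ ?_⟩
  have hsmall : ∀ k < n₀ + 2, N i k ≤ K := fun k hk ↦ by
    have h2 := Finset.single_le_sum (f := fun k ↦ |B k|) (fun _ _ ↦ abs_nonneg _)
      (Finset.mem_range.2 hk)
    have h3 : 0 ≤ |S| / (1 - ρ) := by positivity
    have := hB k i
    have := le_abs_self (B k)
    linarith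
  induction n using Nat.strong_induction_on with
  | _ n ih =>
    rcases lt_or_ge n (n₀ + 2) with h | h
    · exact hsmall n h
    · obtain ⟨k, rfl⟩ : ∃ k, n = k + 2 := ⟨n - 2, by omega⟩
      have h1 := ih k (by omega)
      calc N i (k + 2) ≤ q k * N i k + S := hN i k
        _ ≤ q k * K + S := by gcongr; exact hq0 k
        _ ≤ ρ * K + S := by gcongr; exact hn₀ k (by omega)
        _ ≤ K := by linarith

/-- Solutions of a perturbation of the recurrence `x (n + 4) = 2 c x (n + 2) - x n`, whose
characteristic roots have modulus one for `c ∈ [-1, 1]`, grow subexponentially, uniformly in `c`.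
With `ζ` a root, the quantity `|x (n + 2) - ζ x n| + η |x n|` grows by a factor of at most
`1 + η + o(1)` in each step, an estimate that survives the collision of the roots at `c = ±1`. -/
theorem exists_bound_of_recurrence {x s : Icc (-1 : ℝ) 1 → ℕ → ℝ} {α β : ℕ → ℝ}
    (hα : Tendsto α atTop (𝓝 1)) (hβ : Tendsto β atTop (𝓝 1))
    (hx : ∀ c n, x c (n + 4) = 2 * c * α n * x c (n + 2) - β n * x c n + s c n)
    {r S B : ℝ} (hr₀ : 0 < r) (hr₁ : r < 1) (hs : ∀ c n, |s c n| * r ^ n ≤ S)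
    (hB : ∀ c, ∀ n < 4, |x c n| ≤ B) : ∃ C, ∀ c n, |x c n| * r ^ n ≤ C := by
  -- any `η > 0` with `r ^ 2 * (1 + η) < 1` would do
  set η : ℝ := 1 - r with hη
  have hη0 : 0 < η := by linarith
  set ε : ℕ → ℝ := fun n ↦ 2 * |α n - 1| + |β n - 1|
  have hε0 : ∀ n, 0 ≤ ε n := fun n ↦ by positivity
  have hε : Tendsto ε atTop (𝓝 0) := by
    have h1 : Tendsto (fun n ↦ |α n - 1|) atTop (𝓝 0) := by simpa using (hα.sub_const 1).abs
    have h2 : Tendsto (fun n ↦ |β n - 1|) atTop (𝓝 0) := by simpa using (hβ.sub_const 1).abs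
    simpa using (h1.const_mul 2).add h2
  let ζ : Icc (-1 : ℝ) 1 → ℂ := fun c ↦ ⟨c, √(1 - (c : ℝ) ^ 2)⟩
  have hc1 : ∀ c : Icc (-1 : ℝ) 1, (c : ℝ) ^ 2 ≤ 1 := fun c ↦ by
    rw [sq_le_one_iff_abs_le_one, abs_le]; exact c.2
  have hsq : ∀ c : Icc (-1 : ℝ) 1, √(1 - (c : ℝ) ^ 2) * √(1 - (c : ℝ) ^ 2) = 1 - (c : ℝ) ^ 2 :=
    fun c ↦ Real.mul_self_sqrt (by linarith [hc1 c])
  have hζn : ∀ c, ‖ζ c‖ = 1 := fun c ↦ by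
    rw [Complex.norm_eq_sqrt_sq_add_sq]
    have := hsq c
    rw [Real.sqrt_eq_one]
    simp only [ζ]
    nlinarith
  let y : Icc (-1 : ℝ) 1 → ℕ → ℂ := fun c n ↦ x c (n + 2) - ζ c * x c n
  let M : Icc (-1 : ℝ) 1 → ℕ → ℝ := fun c n ↦ ‖y c n‖ + η * |x c n|
  have hxM : ∀ c n, |x c n| ≤ M c n / η := fun c n ↦ by
    rw [le_div_iff₀ hη0]; linarith [norm_nonneg (y c n)]
  have hx2M : ∀ c n, |x c (n + 2)| ≤ M c n * (1 + 1 / η) := fun c n ↦ by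
    have h1 : (x c (n + 2) : ℂ) = y c n + ζ c * x c n := by simp [y]
    have h2 : |x c (n + 2)| ≤ ‖y c n‖ + |x c n| := by
      rw [← Real.norm_eq_abs, ← Complex.norm_real, h1]
      refine (norm_add_le _ _).trans ?_
      rw [norm_mul, hζn, one_mul, Complex.norm_real, Real.norm_eq_abs]
    have h3 := hxM c n
    have h4 : ‖y c n‖ ≤ M c n := by
      have : 0 ≤ η * |x c n| := by positivity
      simp only [M]; linarith
    calc |x c (n + 2)| ≤ M c n + M c n / η := by linarith
      _ = _ := by ring
  -- for the unperturbed recurrence `y` is multiplied by the other root, the conjugate of `ζ`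
  have hy : ∀ c n, y c (n + 2) = (starRingEnd ℂ) (ζ c) * y c n +
      ((2 * c * (α n - 1) * x c (n + 2) - (β n - 1) * x c n + s c n : ℝ) : ℂ) := fun c n ↦ by
    have h := hsq c
    simp only [y, hx c n]
    apply Complex.ext
    · simp [ζ]; linear_combination (x c n) * h
    · simp [ζ]; ring
  have hyb : ∀ c n, ‖y c (n + 2)‖ ≤ ‖y c n‖ + ε n * (M c n * (1 + 1 / η)) + |s c n| := fun c n ↦ by
    rw [hy]
    refine (norm_add_le _ _).trans ?_
    rw [norm_mul, RCLike.norm_conj, hζn, one_mul, Complex.norm_real, Real.norm_eq_abs]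
    have hc : |(c : ℝ)| ≤ 1 := abs_le.2 c.2
    have hM0 : 0 ≤ M c n := by positivity
    have t1 : |2 * c * (α n - 1) * x c (n + 2)| ≤ 2 * |α n - 1| * (M c n * (1 + 1 / η)) := by
      rw [abs_mul, abs_mul, abs_mul, abs_two]
      gcongr
      · nlinarith [abs_nonneg (α n - 1), abs_nonneg (c : ℝ)]
      · exact hx2M c n
    have t2 : |(β n - 1) * x c n| ≤ |β n - 1| * (M c n * (1 + 1 / η)) := by
      rw [abs_mul]
      gcongr
      refine (hxM c n).trans ?_
      rw [mul_add, mul_one, mul_one_div]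
      linarith
    have t3 := abs_add_le (2 * c * (α n - 1) * x c (n + 2) - (β n - 1) * x c n) (s c n)
    have t4 := abs_sub (2 * c * (α n - 1) * x c (n + 2)) ((β n - 1) * x c n)
    have : ε n * (M c n * (1 + 1 / η)) = 2 * |α n - 1| * (M c n * (1 + 1 / η))
      + |β n - 1| * (M c n * (1 + 1 / η)) := by simp only [ε]; ring
    linarith
  have hMrec : ∀ c n, M c (n + 2) ≤ (1 + η + ε n * (1 + 1 / η)) * M c n + |s c n| := fun c n ↦ by
    have h1 : (x c (n + 2) : ℂ) = y c n + ζ c * x c n := by simp [y]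
    have h2 : |x c (n + 2)| ≤ ‖y c n‖ + |x c n| := by
      rw [← Real.norm_eq_abs, ← Complex.norm_real, h1]
      refine (norm_add_le _ _).trans ?_
      rw [norm_mul, hζn, one_mul, Complex.norm_real, Real.norm_eq_abs]
    have h3 := hyb c n
    have h4 := mul_le_mul_of_nonneg_left h2 hη0.le
    have h5 : 0 ≤ η * (η * |x c n|) := by positivity
    calc M c (n + 2) = ‖y c (n + 2)‖ + η * |x c (n + 2)| := rfl
      _ ≤ (‖y c n‖ + η * |x c n|) + η * (‖y c n‖ + η * |x c n|) +
          ε n * (M c n * (1 + 1 / η)) + |s c n| := by linarith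
      _ = _ := by simp only [M]; ring
  have hMB : ∀ c, ∀ n < 2, M c n ≤ B + B + η * B := fun c n hn ↦ by
    simp only [M, y]
    have h1 := hB c n (by omega)
    have h2 := hB c (n + 2) (by omega)
    have h3 := norm_sub_le (x c (n + 2) : ℂ) (ζ c * x c n)
    rw [norm_mul, hζn, one_mul, Complex.norm_real, Complex.norm_real, Real.norm_eq_abs,
      Real.norm_eq_abs] at h3
    have h4 := mul_le_mul_of_nonneg_left h1 hη0.le
    linarith
  obtain ⟨K, hK⟩ := exists_bound_of_two_step (N := fun c n ↦ M c n * r ^ n)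
    (q := fun n ↦ r ^ 2 * (1 + η + ε n * (1 + 1 / η))) (q₀ := r ^ 2 * (1 + η)) (S := r ^ 2 * S)
    (B₀ := B + B + η * B) (B₁ := (B + B + η * B) * r)
    (by simpa using ((hε.mul_const (1 + 1 / η)).const_add (1 + η)).const_mul (r ^ 2))
    (by rw [hη]; nlinarith [mul_pos hr₀ hη0, mul_pos (mul_pos hr₀ hη0) hη0])
    (fun n ↦ by have := hε0 n; positivity)
    (fun c ↦ by simpa using hMB c 0 (by norm_num))
    (fun c ↦ by
      simp only [pow_one]
      exact mul_le_mul_of_nonneg_right (hMB c 1 (by norm_num)) hr₀.le)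
    (fun c n ↦ by
      have h1 := mul_le_mul_of_nonneg_right (hMrec c n) (pow_pos hr₀ (n + 2)).le
      have h2 := mul_le_mul_of_nonneg_left (hs c n) (sq_nonneg r)
      calc M c (n + 2) * r ^ (n + 2) ≤ _ := h1
        _ = r ^ 2 * (1 + η + ε n * (1 + 1 / η)) * (M c n * r ^ n) + r ^ 2 * (|s c n| * r ^ n) := by
          ring
        _ ≤ _ := by linarith)
  refine ⟨K / η, fun c n ↦ ?_⟩
  rw [le_div_iff₀ hη0]
  have h1 := hK c n
  have h2 := mul_le_mul_of_nonneg_right (hxM c n) (mul_nonneg (pow_pos hr₀ n).le hη0.le)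
  calc |x c n| * r ^ n * η = |x c n| * (r ^ n * η) := by ring
    _ ≤ _ := h2
    _ = M c n * r ^ n := by field_simp
    _ ≤ K := h1

/-! ### Gegenbauer recurrences and the equation in `c` -/

/-- The solution, with initial values `p₀` and `p₁`, of the recurrence
`(ν + j + 2) u (j + 2) = 2 (ν + j + 1 + l) X u (j + 1) - (ν + j + 2 l) u j`
of the Gegenbauer functions of degree `ν + j` and order `l`. The division makes this meaningful only
if `ν + j + 2 ≠ 0` for all `j`. -/
noncomputable def gegenbauerSeq (ν l : ℝ) (p₀ p₁ : ℝ[X]) : ℕ → ℝ[X]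
  | 0 => p₀
  | 1 => p₁
  | j + 2 => C (ν + j + 2)⁻¹ *
      (C (2 * (ν + j + 1 + l)) * X * gegenbauerSeq ν l p₀ p₁ (j + 1)
        - C (ν + j + 2 * l) * gegenbauerSeq ν l p₀ p₁ j)

theorem gegenbauerSeq_rec (ν l : ℝ) (p₀ p₁ : ℝ[X]) (j : ℕ) (h : ν + j + 2 ≠ 0) :
    (C ν + (j : ℝ[X]) + 2) * gegenbauerSeq ν l p₀ p₁ (j + 2) =
      2 * (C ν + (j : ℝ[X]) + 1 + C l) * X * gegenbauerSeq ν l p₀ p₁ (j + 1)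
        - (C ν + (j : ℝ[X]) + 2 * C l) * gegenbauerSeq ν l p₀ p₁ j := by
  have e : C ν + (j : ℝ[X]) + 2 = C (ν + j + 2) := by simp [map_ofNat C 2]
  rw [gegenbauerSeq, e, ← mul_assoc, ← C_mul, mul_inv_cancel₀ h, C_1, one_mul]
  simp only [map_add, map_mul, map_one, map_ofNat, map_natCast]

/-- Derivatives of the two fundamental solutions `a` and `d` of the Gegenbauer recurrence. A
Gegenbauer function satisfies
`(1 - X ^ 2) u' j = (ν + j + 2 l) X u j - (ν + j + 1) u (j + 1)`. Since `u = d * u 0 + a * u 1`, the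
derivatives of `a` and `d` combine this relation at `j` with the same relation at `0`. -/
theorem gegenbauerSeq_ladder (ν l : ℝ) (hν : ∀ j : ℕ, ν + j + 2 ≠ 0) (j : ℕ) :
    let a := gegenbauerSeq ν l 0 1
    let d := gegenbauerSeq ν l 1 0
    let N : ℝ[X] := C ν + (j : ℝ[X])
    (1 - X ^ 2) * derivative (a j) =
        (N + 2 * C l + C ν + 1) * X * a j - (N + 1) * a (j + 1) + (C ν + 1) * d j ∧
    (1 - X ^ 2) * derivative (a (j + 1)) =
        (N + 2 * C l) * a j + (C ν - N) * X * a (j + 1) + (C ν + 1) * d (j + 1) ∧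
    (1 - X ^ 2) * derivative (d j) =
        (N - C ν) * X * d j - (N + 1) * d (j + 1) - (C ν + 2 * C l) * a j ∧
    (1 - X ^ 2) * derivative (d (j + 1)) =
        (N + 2 * C l) * d j - (N + 1 + C ν + 2 * C l) * X * d (j + 1)
          - (C ν + 2 * C l) * a (j + 1) := by
  intro a d
  induction j with
  | zero => simp [a, d, gegenbauerSeq]
  | succ j ih =>
    obtain ⟨h1, h2, h3, h4⟩ := ih
    have ha := gegenbauerSeq_rec ν l 0 1 j (hν j)
    have hd := gegenbauerSeq_rec ν l 1 0 j (hν j)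
    have ha' := congrArg derivative ha
    have hd' := congrArg derivative hd
    simp only [derivative_mul, derivative_add, derivative_sub, derivative_C, derivative_X,
      derivative_natCast, derivative_ofNat, derivative_one] at ha' hd'
    have hne : (C ν + (j : ℝ[X]) + 2) ≠ 0 := by
      have e : C ν + (j : ℝ[X]) + 2 = C (ν + j + 2) := by simp [map_ofNat C 2]
      rw [e]; exact C_ne_zero.2 (hν j)
    simp only [Nat.cast_add, Nat.cast_one]
    refine ⟨?_, ?_, ?_, ?_⟩
    · linear_combination h2 + ha
    · refine mul_left_cancel₀ hne ?_
      linear_combination (1 - X ^ 2) * ha' + 2 * (C ν + (j : ℝ[X]) + 1 + C l) * X * h2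
        - (C ν + (j : ℝ[X]) + 2 * C l) * h1 - (C ν - (C ν + (j : ℝ[X]) + 1)) * X * ha
        - (C ν + 1) * hd
    · linear_combination h4 + hd
    · refine mul_left_cancel₀ hne ?_
      linear_combination (1 - X ^ 2) * hd' + 2 * (C ν + (j : ℝ[X]) + 1 + C l) * X * h4
        - (C ν + (j : ℝ[X]) + 2 * C l) * h3 + (C ν + (j : ℝ[X]) + 2 + C ν + 2 * C l) * X * hd
        + (C ν + 2 * C l) * ha

/-- Given first-order relations for `a`, `a₁`, `d`, `d₁`, a linear combination of these, divided by
a power of `1 - X ^ 2`, has a derivative of the same form. -/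
theorem pow_mul_derivative_of_ladder {a a₁ d d₁ p q s t : ℝ[X]}
    (h₁ : (1 - X ^ 2) * derivative a = (p + s) * X * a - q * a₁ + s * d)
    (h₂ : (1 - X ^ 2) * derivative a₁ = p * a + (s - q) * X * a₁ + s * d₁)
    (h₃ : (1 - X ^ 2) * derivative d = (p - t) * X * d - q * d₁ - t * a)
    (h₄ : (1 - X ^ 2) * derivative d₁ = p * d - (q + t) * X * d₁ - t * a₁)
    (k : ℕ) {x α β γ η : ℝ[X]}
    (h : (1 - X ^ 2) ^ k * x = α * a + β * a₁ + γ * d + η * d₁) :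
    (1 - X ^ 2) ^ (k + 1) * derivative x =
      (2 * (k : ℝ[X]) * X * α + (1 - X ^ 2) * derivative α + (p + s) * X * α + p * β - t * γ) * a
      + (2 * (k : ℝ[X]) * X * β + (1 - X ^ 2) * derivative β - q * α + (s - q) * X * β - t * η) * a₁
      + (2 * (k : ℝ[X]) * X * γ + (1 - X ^ 2) * derivative γ + s * α + (p - t) * X * γ + p * η) * d
      + (2 * (k : ℝ[X]) * X * η + (1 - X ^ 2) * derivative η + s * β - q * γ - (q + t) * X * η)
        * d₁ := by
  have h' := congrArg derivative h
  have hw : (1 - X ^ 2) * derivative ((1 - X ^ 2 : ℝ[X]) ^ k) =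
      -(2 * (k : ℝ[X]) * X * (1 - X ^ 2) ^ k) := by
    rcases k with _ | k
    · simp
    · rw [derivative_pow_succ]
      simp only [derivative_sub, derivative_one, derivative_X_pow, map_add, map_natCast, map_one,
        Nat.cast_add, Nat.cast_one, Nat.cast_ofNat, map_ofNat C 2]
      ring
  rw [derivative_mul] at h'
  simp only [derivative_add, derivative_mul] at h'
  linear_combination (1 - X ^ 2) * h' - x * hw + 2 * (k : ℝ[X]) * X * h
    + α * h₁ + β * h₂ + γ * h₃ + η * h₄

/-- The fourth-order equation: four unknowns with first-order relations satisfy a linear equation of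
order four, and for `ν₀ = -3 / 2 - 2 l` it takes the present form. Here `ν` is the shifted degree
`ν₀ + j`, and `B` is a quarter of the image of `a` under the coefficient form of `opL`. -/
theorem ladder_fourth_order {a a₁ d d₁ : ℝ[X]} {ν ν₀ l κ : ℝ}
    (hν₀ : ν₀ = -3 / 2 - 2 * l) (hκ : κ = ν ^ 2 + 2 * l * ν - 13 / 4 - 3 * l)
    (h₁ : (1 - X ^ 2) * derivative a =
      (C ν + 2 * C l + (C ν₀ + 1)) * X * a - (C ν + 1) * a₁ + (C ν₀ + 1) * d)
    (h₂ : (1 - X ^ 2) * derivative a₁ =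
      (C ν + 2 * C l) * a + (C ν₀ + 1 - (C ν + 1)) * X * a₁ + (C ν₀ + 1) * d₁)
    (h₃ : (1 - X ^ 2) * derivative d =
      (C ν + 2 * C l - (C ν₀ + 2 * C l)) * X * d - (C ν + 1) * d₁ - (C ν₀ + 2 * C l) * a)
    (h₄ : (1 - X ^ 2) * derivative d₁ =
      (C ν + 2 * C l) * d - (C ν + 1 + (C ν₀ + 2 * C l)) * X * d₁ - (C ν₀ + 2 * C l) * a₁)
    {B : ℝ[X]}
    (hB : B = (1 - X ^ 2) * derivative (derivative a) - 3 * X * derivative a + C κ * a) :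
    (1 - X ^ 2) * derivative (derivative B) - 3 * X * derivative B + C κ * B
      + C (9 + 16 * l) * derivative (derivative a)
      - C ((3 + 2 * l) ^ 2) * (X ^ 2 * derivative (derivative a) + 3 * X * derivative a + a)
      = 0 := by
  have key := fun k x α β γ η ↦
    pow_mul_derivative_of_ladder (x := x) (α := α) (β := β) (γ := γ) (η := η) h₁ h₂ h₃ h₄ k
  set p : ℝ[X] := C ν + 2 * C l with hp
  set q : ℝ[X] := C ν + 1 with hq
  set s : ℝ[X] := C ν₀ + 1 with hs
  set t : ℝ[X] := C ν₀ + 2 * C l with ht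
  have a1 := key 1 (derivative a) ((p + s) * X) (-q) s 0 (by linear_combination h₁)
  have b0 : (1 - X ^ 2) ^ 1 * B =
      (C κ + p + s - q * p - s * t + C ((ν + 2 * l + ν₀ + 1) * (ν + 2 * l + ν₀)
        - (ν + 2 * l + ν₀ + 1) - κ) * X ^ 2) * a
      + C (-(ν + 1) * (2 * ν₀ + 2 * l)) * X * a₁ + C ((ν₀ + 1) * (2 * ν + 2 * l)) * X * d
      + C (-2 * (ν + 1) * (ν₀ + 1)) * d₁ := by
    rw [hB]
    simp only [map_add, map_mul, map_sub, map_neg, map_one, map_ofNat C 2, hp, hq, hs, ht]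
      at a1 h₁ ⊢
    simp only [derivative_mul, derivative_add, derivative_C, derivative_X,
      derivative_one, derivative_ofNat, derivative_zero, Nat.cast_one] at a1
    linear_combination a1 - 3 * X * h₁
  have b1 := key 1 _ _ _ _ _ b0
  have b2 := key 2 _ _ _ _ _ b1
  have hw : ((1 - X ^ 2 : ℝ[X])) ^ 3 ≠ 0 := by
    refine pow_ne_zero 3 fun h ↦ ?_
    simpa using congrArg (eval 0) h
  refine mul_left_cancel₀ hw ?_
  rw [mul_zero]
  simp only [hp, hq, hs, ht, derivative_mul, derivative_add, derivative_sub, derivative_neg,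
    derivative_C, derivative_X, derivative_one, derivative_ofNat, derivative_zero,
    derivative_natCast, derivative_X_pow] at a1 b1 b2
  -- the relation for `ν₀` has fractional coefficients, so the rest is computed in the field `ℝ`
  refine Polynomial.funext fun x ↦ ?_
  replace h₁ := congrArg (eval x) h₁
  replace a1 := congrArg (eval x) a1
  replace b0 := congrArg (eval x) b0
  replace b1 := congrArg (eval x) b1
  replace b2 := congrArg (eval x) b2
  clear key hB h₂ h₃ h₄ hw
  simp only [hp, hq, hs, ht, eval_add, eval_sub, eval_mul, eval_pow, eval_neg, eval_C, eval_X,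
    eval_one, eval_zero, eval_ofNat, Nat.cast_one, Nat.cast_ofNat] at h₁ a1 b0 b1 b2 ⊢
  clear hp hq hs ht p q s t
  generalize eval x (derivative (derivative B)) = B2 at *
  generalize eval x (derivative B) = B1 at *
  generalize eval x B = B0 at *
  generalize eval x (derivative (derivative a)) = y2 at *
  generalize eval x (derivative a) = y1 at *
  generalize eval x a = y at *
  generalize eval x a₁ = y' at *
  generalize eval x d = z at *
  generalize eval x d₁ = z' at *
  subst hν₀ hκ
  linear_combination (1 - x ^ 2) * b2 - 3 * x * (1 - x ^ 2) * b1
    + (ν ^ 2 + 2 * l * ν - 13 / 4 - 3 * l) * (1 - x ^ 2) ^ 2 * b0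
    + (9 + 16 * l) * (1 - x ^ 2) * a1
    - (3 + 2 * l) ^ 2 * (x ^ 2 * (1 - x ^ 2) * a1 + 3 * x * (1 - x ^ 2) ^ 2 * h₁)

/-- Action of `opL` on the coefficients of a power series in `z`. -/
noncomputable def coeffL (m : ℕ) (p : ℕ → ℝ[X]) (n : ℕ) : ℝ[X] :=
  4 * (1 - X ^ 2) * derivative (derivative (p n)) - 12 * X * derivative (p n)
    + C ((n : ℝ) ^ 2 + 2 * (2 / (m : ℝ) - 3) * n - 4) * p n

/-- Action of `opE` on the coefficients of a power series in `z`. -/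
noncomputable def coeffE (p : ℕ → ℝ[X]) (n : ℕ) : ℝ[X] := X * derivative (p n) + p n

theorem poly2_odd (m j : ℕ) : poly2 m (2 * j + 1) = 0 := by
  induction j using Nat.twoStepInduction with
  | zero => simp [poly2]
  | one => simp [poly2]
  | more j ih₀ ih₁ =>
    rw [show 2 * (j + 2) + 1 = (2 * j + 1) + 4 by ring, poly2, ih₀,
      show 2 * j + 1 + 2 = 2 * (j + 1) + 1 by ring, ih₁]
    simp

/-- In the variable `z ^ 2` the coefficients are Gegenbauer-type polynomials of order `-1 / m`, with
degrees shifted by `2 / m - 3 / 2`. -/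
theorem poly2_even {m : ℕ} (hm : m ≠ 0) (j : ℕ) :
    poly2 m (2 * j) = gegenbauerSeq (2 / m - 3 / 2) (-1 / m) 0 1 j := by
  induction j using Nat.twoStepInduction with
  | zero => simp [poly2, gegenbauerSeq]
  | one => simp [poly2, gegenbauerSeq]
  | more j ih₀ ih₁ =>
    have hm' : (m : ℝ) ≠ 0 := Nat.cast_ne_zero.2 hm
    have hd : ((2 * j : ℕ) : ℝ) * m + m + 4 = 2 * m * (2 / m - 3 / 2 + j + 2) := by
      push_cast; field_simp; ring
    rw [show 2 * (j + 2) = 2 * j + 4 by ring, poly2, show 2 * j + 2 = 2 * (j + 1) by ring, ih₀, ih₁,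
      gegenbauerSeq, hd, mul_inv, C_mul, mul_comm (C _) (C _), mul_assoc (C _)]
    congr 1
    rw [mul_sub, ← mul_assoc, ← mul_assoc, ← mul_assoc, ← C_mul, ← C_mul]
    congr 4
    all_goals push_cast; field_simp; ring

/-- The partial differential equation, coefficient by coefficient. -/
theorem poly2_fourth_order {m : ℕ} (hm : m ≠ 0) (n : ℕ) :
    C ((m : ℝ) ^ 2) * coeffL m (coeffL m (poly2 m)) n
      + C (144 * (m : ℝ) ^ 2 - 256 * (m : ℝ)) * derivative (derivative (poly2 m n))
      - C (16 * (3 * (m : ℝ) - 2) ^ 2) * coeffE (coeffE (poly2 m)) n = 0 := by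
  obtain ⟨j, rfl | rfl⟩ := n.even_or_odd'
  swap
  · simp [coeffL, coeffE, poly2_odd]
  have hm' : (m : ℝ) ≠ 0 := Nat.cast_ne_zero.2 hm
  have hν : ∀ i : ℕ, (2 / m - 3 / 2 : ℝ) + i + 2 ≠ 0 := fun i ↦ by
    have : (0 : ℝ) ≤ 2 / m + i := by positivity
    linarith
  obtain ⟨h₁, h₂, h₃, h₄⟩ := gegenbauerSeq_ladder (2 / m - 3 / 2) (-1 / m) hν j
  set ν₀ : ℝ := 2 / m - 3 / 2 with hν₀
  set l : ℝ := -1 / m with hl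
  set κ : ℝ := (ν₀ + j) ^ 2 + 2 * l * (ν₀ + j) - 13 / 4 - 3 * l with hκ
  have h := ladder_fourth_order (ν := ν₀ + j) (ν₀ := ν₀) (l := l) (κ := κ)
    (a := gegenbauerSeq ν₀ l 0 1 j) (a₁ := gegenbauerSeq ν₀ l 0 1 (j + 1))
    (d := gegenbauerSeq ν₀ l 1 0 j) (d₁ := gegenbauerSeq ν₀ l 1 0 (j + 1))
    (by rw [hν₀, hl]; ring) rfl
    (by rw [h₁]; simp only [map_add, map_natCast]; ring)
    (by rw [h₂]; simp only [map_add, map_natCast]; ring)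
    (by rw [h₃]; simp only [map_add, map_natCast]; ring)
    (by rw [h₄]; simp only [map_add, map_natCast]; ring) rfl
  rw [← poly2_even hm] at h
  set a := poly2 m (2 * j)
  have hκ4 : ((2 * j : ℕ) : ℝ) ^ 2 + 2 * (2 / (m : ℝ) - 3) * ((2 * j : ℕ) : ℝ) - 4 = 4 * κ := by
    rw [hκ, hν₀, hl]; push_cast; field_simp; ring
  have e1 : C (144 * (m : ℝ) ^ 2 - 256 * (m : ℝ)) = 16 * C ((m : ℝ) ^ 2) * C (9 + 16 * l) := by
    rw [← map_ofNat C 16, ← C_mul, ← C_mul, hl]; congr 1; field_simp; ring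
  have e2 : C (16 * (3 * (m : ℝ) - 2) ^ 2) = 16 * C ((m : ℝ) ^ 2) * C ((3 + 2 * l) ^ 2) := by
    rw [← map_ofNat C 16, ← C_mul, ← C_mul, hl]; congr 1; field_simp; ring
  have hL : ∀ p : ℕ → ℝ[X], coeffL m p (2 * j) =
      4 * ((1 - X ^ 2) * derivative (derivative (p (2 * j))) - 3 * X * derivative (p (2 * j))
        + C κ * p (2 * j)) := fun p ↦ by
    rw [coeffL, hκ4, C_mul, map_ofNat C 4]; ring
  rw [hL, hL, e1, e2, coeffE, coeffE]
  simp only [derivative_mul, derivative_add, derivative_sub, derivative_C, derivative_X,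
    derivative_one, derivative_zero, derivative_ofNat, derivative_X_pow] at h ⊢
  linear_combination 16 * C ((m : ℝ) ^ 2) * h

/-! ### Subexponential growth of the coefficients and their derivatives -/

/-- The values on `[-1, 1]` of a sequence of polynomials grow more slowly than any geometric
sequence of ratio greater than one, uniformly in `c`. -/
def SubexpBound (p : ℕ → ℝ[X]) : Prop :=
  ∀ r : ℝ, 0 < r → r < 1 → ∃ B, ∀ c ∈ Icc (-1 : ℝ) 1, ∀ n, |(p n).eval c| * r ^ n ≤ B

/-- All derivatives of a sequence of polynomials have subexponential growth on `[-1, 1]`. -/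
def Moderate (p : ℕ → ℝ[X]) : Prop := ∀ i : ℕ, SubexpBound fun n ↦ derivative^[i] (p n)

theorem iterate_derivative_X_mul (p : ℝ[X]) (i : ℕ) :
    derivative^[i] (X * p) = X * derivative^[i] p + (i : ℝ[X]) * derivative^[i - 1] p := by
  induction i with
  | zero => simp
  | succ i ih =>
    rw [Function.iterate_succ_apply', ih]
    rcases i with _ | i
    · simp [add_comm]
    · simp only [derivative_add, derivative_mul, derivative_X, derivative_natCast,
        Nat.add_sub_cancel, ← Function.iterate_succ_apply']
      push_cast
      ring

namespace SubexpBound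

variable {p q : ℕ → ℝ[X]}

theorem add (hp : SubexpBound p) (hq : SubexpBound q) : SubexpBound fun n ↦ p n + q n := by
  intro r h0 h1
  obtain ⟨A, hA⟩ := hp r h0 h1
  obtain ⟨B, hB⟩ := hq r h0 h1
  refine ⟨A + B, fun c hc n ↦ ?_⟩
  rw [eval_add]
  calc _ ≤ (|(p n).eval c| + |(q n).eval c|) * r ^ n := by gcongr; exact abs_add_le _ _
    _ ≤ _ := by linarith [hA c hc n, hB c hc n]

/-- Factors of linear growth are absorbed by a smaller radius. -/
theorem mul_of_le (hp : SubexpBound p) {K : ℝ}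
    (hq : ∀ c ∈ Icc (-1 : ℝ) 1, ∀ n, |(q n).eval c| ≤ K * (n + 1)) :
    SubexpBound fun n ↦ q n * p n := by
  intro r h0 h1
  obtain ⟨ρ, hρ0, hρ1⟩ := exists_between h1
  have hρ : 0 < ρ := h0.trans hρ0
  obtain ⟨A, hA⟩ := hp ρ hρ hρ1
  have hrr : |r / ρ| < 1 := by
    rw [abs_of_pos (div_pos h0 hρ)]; exact (div_lt_one hρ).2 hρ0
  have ht : Tendsto (fun n : ℕ ↦ ((n : ℝ) + 1) * (r / ρ) ^ n) atTop (𝓝 0) := by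
    simpa [add_mul] using (tendsto_self_mul_const_pow_of_abs_lt_one hrr).add
      (tendsto_pow_atTop_nhds_zero_of_abs_lt_one hrr)
  obtain ⟨D, hD⟩ := ht.bddAbove_range
  refine ⟨|K| * D * A, fun c hc n ↦ ?_⟩
  have hD' : ((n : ℝ) + 1) * (r / ρ) ^ n ≤ D := hD ⟨n, rfl⟩
  have hD0 : 0 ≤ ((n : ℝ) + 1) * (r / ρ) ^ n := by positivity
  have hq' : |(q n).eval c| ≤ |K| * (n + 1) :=
    (hq c hc n).trans (by gcongr; exact le_abs_self K)
  have e : r ^ n = (r / ρ) ^ n * ρ ^ n := by rw [← mul_pow, div_mul_cancel₀ _ hρ.ne']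
  calc |(q n * p n).eval c| * r ^ n
      = |(q n).eval c| * (r / ρ) ^ n * (|(p n).eval c| * ρ ^ n) := by
        rw [eval_mul, abs_mul, e]; ring
    _ ≤ |K| * (n + 1) * (r / ρ) ^ n * A := by gcongr; exact hA c hc n
    _ = |K| * ((n + 1) * (r / ρ) ^ n) * A := by ring
    _ ≤ |K| * D * A := by
        have hA0 : 0 ≤ A := (by positivity : (0 : ℝ) ≤ |(p n).eval c| * ρ ^ n).trans (hA c hc n)
        gcongr

theorem C_mul (hp : SubexpBound p) {a : ℕ → ℝ} {K : ℝ} (ha : ∀ n : ℕ, |a n| ≤ K * (n + 1)) :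
    SubexpBound fun n ↦ C (a n) * p n :=
  hp.mul_of_le fun c _ n ↦ by simpa using ha n

theorem X_mul (hp : SubexpBound p) : SubexpBound fun n ↦ X * p n :=
  hp.mul_of_le (K := 1) fun c hc n ↦ by
    have : |c| ≤ 1 := abs_le.2 hc
    rw [eval_X]
    linarith [(Nat.cast_nonneg n : (0 : ℝ) ≤ n)]

theorem shift (hp : SubexpBound p) : SubexpBound fun n ↦ p (n + 1) := by
  intro r h0 h1
  obtain ⟨A, hA⟩ := hp r h0 h1
  refine ⟨A / r, fun c hc n ↦ ?_⟩
  rw [le_div_iff₀ h0, mul_assoc, ← pow_succ]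
  exact hA c hc (n + 1)

end SubexpBound

namespace Moderate

variable {p q : ℕ → ℝ[X]}

theorem derivative (hp : Moderate p) : Moderate fun n ↦ derivative (p n) :=
  fun i ↦ hp (i + 1)

theorem add (hp : Moderate p) (hq : Moderate q) : Moderate fun n ↦ p n + q n := fun i ↦ by
  simpa only [iterate_map_add] using (hp i).add (hq i)

theorem C_mul (hp : Moderate p) {a : ℕ → ℝ} {K : ℝ} (ha : ∀ n : ℕ, |a n| ≤ K * (n + 1)) :
    Moderate fun n ↦ C (a n) * p n := fun i ↦ by
  simpa only [iterate_derivative_C_mul] using (hp i).C_mul ha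

theorem const_mul (hp : Moderate p) (a : ℝ) : Moderate fun n ↦ C a * p n :=
  hp.C_mul (K := |a|) fun n ↦ by
    have : 0 ≤ |a| * n := by positivity
    linarith

theorem natCast_mul (hp : Moderate p) : Moderate fun n ↦ C (n : ℝ) * p n :=
  hp.C_mul (K := 1) fun n ↦ by simp

theorem X_mul (hp : Moderate p) : Moderate fun n ↦ X * p n := fun i ↦ by
  rcases i with _ | i
  · exact (hp 0).X_mul
  · have e : (fun n ↦ Polynomial.derivative^[i + 1] (X * p n)) =
        fun n ↦ X * Polynomial.derivative^[i + 1] (p n) +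
          C ((i : ℝ) + 1) * Polynomial.derivative^[i] (p n) := by
      funext n
      rw [iterate_derivative_X_mul]
      simp
    rw [e]
    exact (hp (i + 1)).X_mul.add
      ((hp i).C_mul (a := fun _ ↦ (i : ℝ) + 1) (K := i + 1) fun n ↦ by
        rw [abs_of_nonneg (by positivity)]
        nlinarith [(Nat.cast_nonneg n : (0 : ℝ) ≤ n), (Nat.cast_nonneg i : (0 : ℝ) ≤ i)])

theorem shift (hp : Moderate p) : Moderate fun n ↦ p (n + 1) := fun i ↦ (hp i).shift

end Moderate

/-- The coefficients of the recursion, divided by the leading one, tend to those of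
`x (n + 4) = 2 c x (n + 2) - x n`. -/
theorem tendsto_ratio {m : ℕ} (hm : m ≠ 0) (a b : ℝ) :
    Tendsto (fun k : ℕ ↦ ((k : ℝ) * m + m + 4)⁻¹ * (((k : ℝ) + a) * m + b)) atTop (𝓝 1) := by
  have hm' : (0 : ℝ) < m := by positivity
  have h1 : Tendsto (fun k : ℕ ↦ (k : ℝ) * m + (m + 4)) atTop atTop :=
    tendsto_atTop_add_const_right _ _ (tendsto_natCast_atTop_atTop.atTop_mul_const hm')
  have h2 := (h1.inv_tendsto_atTop.const_mul (a * m + b - m - 4)).const_add 1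
  rw [mul_zero, add_zero] at h2
  refine h2.congr fun k ↦ ?_
  have : (k : ℝ) * m + (m + 4) ≠ 0 := by positivity
  have : (k : ℝ) * m + m + 4 ≠ 0 := by positivity
  simp only [Pi.inv_apply]
  field_simp
  ring

/-- The recursion differentiated `i` times. The truncation in `i - 1` is harmless at `i = 0`, where
the factor `i` vanishes. -/
theorem poly2_iterate_derivative (m i n : ℕ) :
    derivative^[i] (poly2 m (n + 4)) = C ((n : ℝ) * m + m + 4)⁻¹ *
      (C (2 * (((n : ℝ) - 1) * m + 2)) *
        (X * derivative^[i] (poly2 m (n + 2)) + (i : ℝ[X]) * derivative^[i - 1] (poly2 m (n + 2)))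
        - C (((n : ℝ) - 3) * m) * derivative^[i] (poly2 m n)) := by
  rw [poly2, iterate_derivative_C_mul, iterate_derivative_sub, mul_assoc, iterate_derivative_C_mul,
    iterate_derivative_C_mul, iterate_derivative_X_mul]

theorem moderate_poly2 {m : ℕ} (hm : m ≠ 0) : Moderate (poly2 m) := by
  -- the `i`-th derivatives obey the recursion up to a source of `(i - 1)`-st derivatives
  have main : ∀ (i : ℕ) (s : Icc (-1 : ℝ) 1 → ℕ → ℝ),
      (∀ c n, s c n = 2 * (((n : ℝ) * m + m + 4)⁻¹ * (((n : ℝ) + (-1)) * m + 2)) *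
        (i * (derivative^[i - 1] (poly2 m (n + 2))).eval (c : ℝ))) →
      (∀ r : ℝ, 0 < r → r < 1 → ∃ S, ∀ c n, |s c n| * r ^ n ≤ S) →
      SubexpBound fun n ↦ derivative^[i] (poly2 m n) := by
    intro i s hs hS r h0 h1
    obtain ⟨S, hS⟩ := hS r h0 h1
    obtain ⟨C, hC⟩ := exists_bound_of_recurrence (B := 1)
      (x := fun c n ↦ (derivative^[i] (poly2 m n)).eval (c : ℝ)) (s := s)
      (tendsto_ratio hm (-1) 2) (tendsto_ratio hm (-3) 0)
      (fun c n ↦ by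
        rw [hs, poly2_iterate_derivative]
        simp only [eval_mul, eval_sub, eval_add, eval_C, eval_X, eval_natCast]
        ring) h0 h1 hS
      (fun c n hn ↦ by
        interval_cases n <;> rcases i with _ | i <;> simp [poly2, iterate_derivative_one])
    exact ⟨C, fun c hc n ↦ hC ⟨c, hc⟩ n⟩
  intro i
  induction i with
  | zero =>
    refine main 0 (fun _ _ ↦ 0) (fun c n ↦ by simp) fun r _ _ ↦ ⟨0, by simp⟩
  | succ i ih =>
    refine main (i + 1) _ (fun c n ↦ rfl) fun r h0 h1 ↦ ?_
    obtain ⟨D, hD⟩ := (tendsto_ratio hm (-1) 2).abs.bddAbove_range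
    obtain ⟨A, hA⟩ := ih.shift.shift r h0 h1
    refine ⟨2 * D * ((i + 1) * A), fun c n ↦ ?_⟩
    have hD' : |((n : ℝ) * m + m + 4)⁻¹ * (((n : ℝ) + (-1)) * m + 2)| ≤ D := hD ⟨n, rfl⟩
    have hA' := hA c c.2 n
    have hD0 : 0 ≤ D := (abs_nonneg _).trans hD'
    have hi : |(i : ℝ) + 1| = i + 1 := abs_of_nonneg (by positivity)
    rw [abs_mul, abs_mul 2, abs_two, abs_mul ((i + 1 : ℕ) : ℝ), Nat.cast_add, Nat.cast_one, hi,
      Nat.add_sub_cancel, mul_assoc, mul_assoc ((i : ℝ) + 1)]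
    gcongr

/-! ### Power series with polynomial coefficients -/

/-- The sum of the power series in `z` with polynomial coefficients `p n` in `c`. -/
noncomputable def polySeries (p : ℕ → ℝ[X]) (c z : ℝ) : ℝ := ∑' n : ℕ, (p n).eval c * z ^ n

/-- Coefficients of the `z`-derivative of a power series. -/
noncomputable def zDeriv (p : ℕ → ℝ[X]) (n : ℕ) : ℝ[X] := C ((n : ℝ) + 1) * p (n + 1)

variable {p : ℕ → ℝ[X]}

theorem SubexpBound.exists_summable_bound (hp : SubexpBound p) {R : ℝ} (hR0 : 0 ≤ R) (hR : R < 1) :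
    ∃ u : ℕ → ℝ, Summable u ∧ ∀ c ∈ Icc (-1 : ℝ) 1, ∀ z : ℝ, |z| ≤ R → ∀ n,
      ‖(p n).eval c * z ^ n‖ ≤ u n := by
  obtain ⟨r, hr0, hr1⟩ := exists_between hR
  have hr : 0 < r := hR0.trans_lt hr0
  obtain ⟨B, hB⟩ := hp r hr hr1
  refine ⟨fun n ↦ B * (R / r) ^ n, ?_, fun c hc z hz n ↦ ?_⟩
  · exact (summable_geometric_of_lt_one (by positivity) ((div_lt_one hr).2 hr0)).mul_left B
  · have e : R ^ n = r ^ n * (R / r) ^ n := by rw [← mul_pow, mul_div_cancel₀ _ hr.ne']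
    rw [norm_mul, norm_pow, Real.norm_eq_abs, Real.norm_eq_abs]
    calc |(p n).eval c| * |z| ^ n ≤ |(p n).eval c| * R ^ n := by gcongr
      _ = |(p n).eval c| * r ^ n * (R / r) ^ n := by rw [e, mul_assoc]
      _ ≤ B * (R / r) ^ n := by gcongr; exact hB c hc n

theorem SubexpBound.summable (hp : SubexpBound p) {c z : ℝ} (hc : c ∈ Icc (-1 : ℝ) 1)
    (hz : z ∈ Ioo (-1 : ℝ) 1) : Summable fun n ↦ (p n).eval c * z ^ n := by
  obtain ⟨u, hu, h⟩ := hp.exists_summable_bound (abs_nonneg z) (abs_lt.2 hz)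
  exact .of_norm_bounded hu (h c hc z le_rfl)

theorem SubexpBound.zDeriv (hp : SubexpBound p) : SubexpBound (zDeriv p) :=
  hp.shift.C_mul (K := 1) fun n ↦ by rw [abs_of_nonneg (by positivity)]; linarith

theorem Moderate.zDeriv (hp : Moderate p) : Moderate (zDeriv p) :=
  hp.shift.C_mul (K := 1) fun n ↦ by rw [abs_of_nonneg (by positivity)]; linarith

theorem Moderate.subexpBound (hp : Moderate p) : SubexpBound p := hp 0

@[simp]
theorem polySeries_zero (p : ℕ → ℝ[X]) (c : ℝ) : polySeries p c 0 = (p 0).eval c := by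
  rw [polySeries, tsum_eq_single 0 fun n hn ↦ by simp [hn]]
  simp

theorem SubexpBound.hasSum (hp : SubexpBound p) {c z : ℝ} (hc : c ∈ Icc (-1 : ℝ) 1)
    (hz : z ∈ Ioo (-1 : ℝ) 1) : HasSum (fun n ↦ (p n).eval c * z ^ n) (polySeries p c z) :=
  (hp.summable hc hz).hasSum

theorem SubexpBound.hasSum_zDeriv (hp : SubexpBound p) {c z : ℝ} (hc : c ∈ Icc (-1 : ℝ) 1)
    (hz : z ∈ Ioo (-1 : ℝ) 1) :
    HasSum (fun n : ℕ ↦ (p n).eval c * (n * z ^ (n - 1)))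
      (polySeries (Superelliptic.zDeriv p) c z) := by
  have h := hp.zDeriv.hasSum hc hz
  rw [← hasSum_nat_add_iff' 1]
  simpa [Superelliptic.zDeriv, mul_assoc, mul_comm, mul_left_comm] using h

theorem SubexpBound.exists_summable_bound_deriv (hp : SubexpBound p) {R : ℝ} (hR0 : 0 ≤ R)
    (hR : R < 1) :
    ∃ u : ℕ → ℝ, Summable u ∧ ∀ c ∈ Icc (-1 : ℝ) 1, ∀ z : ℝ, |z| ≤ R → ∀ n : ℕ,
      ‖(p n).eval c * (n * z ^ (n - 1))‖ ≤ u n := by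
  obtain ⟨u, hu, h⟩ := hp.zDeriv.exists_summable_bound hR0 hR
  refine ⟨fun n : ℕ ↦ if n = 0 then 0 else u (n - 1), ?_, fun c hc z hz n ↦ ?_⟩
  · rw [← summable_nat_add_iff 1]; simpa using hu
  · rcases n with _ | n
    · simp
    · simpa [Superelliptic.zDeriv, mul_assoc, mul_comm, mul_left_comm] using h c hc z hz n

/-- Joint termwise differentiation in the open square. -/
theorem SubexpBound.hasFDerivAt_polySeries (hp : SubexpBound p)
    (hp' : SubexpBound fun n ↦ derivative (p n)) {c z : ℝ} (hc : c ∈ Ioo (-1 : ℝ) 1)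
    (hz : z ∈ Ioo (-1 : ℝ) 1) :
    HasFDerivAt (fun x : ℝ × ℝ ↦ polySeries p x.1 x.2)
      (polySeries (fun n ↦ derivative (p n)) c z • ContinuousLinearMap.fst ℝ ℝ ℝ
        + polySeries (Superelliptic.zDeriv p) c z • ContinuousLinearMap.snd ℝ ℝ ℝ) (c, z) := by
  obtain ⟨R, hzR, hR1⟩ := exists_between (abs_lt.2 hz)
  have hR0 : 0 < R := (abs_nonneg z).trans_lt hzR
  obtain ⟨u, hu, hub⟩ := hp'.exists_summable_bound hR0.le hR1
  obtain ⟨v, hv, hvb⟩ := hp.exists_summable_bound_deriv hR0.le hR1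
  have hcz : (c, z) ∈ Ioo (-1 : ℝ) 1 ×ˢ Ioo (-R) R := ⟨hc, abs_lt.1 hzR⟩
  have hcI := Ioo_subset_Icc_self hc
  have hsum := ((hp'.hasSum hcI hz).smul_const (ContinuousLinearMap.fst ℝ ℝ ℝ)).add
    ((hp.hasSum_zDeriv hcI hz).smul_const (ContinuousLinearMap.snd ℝ ℝ ℝ))
  rw [← hsum.tsum_eq]
  refine hasFDerivAt_tsum_of_isPreconnected (hu.add hv) (isOpen_Ioo.prod isOpen_Ioo)
    (isPreconnected_Ioo.prod isPreconnected_Ioo)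
    (f := fun n (x : ℝ × ℝ) ↦ (p n).eval x.1 * x.2 ^ n)
    (f' := fun n (x : ℝ × ℝ) ↦
      ((derivative (p n)).eval x.1 * x.2 ^ n) • ContinuousLinearMap.fst ℝ ℝ ℝ
        + ((p n).eval x.1 * (n * x.2 ^ (n - 1))) • ContinuousLinearMap.snd ℝ ℝ ℝ)
    (fun n x _ ↦ ?_) (fun n x hx ↦ ?_) hcz (hp.summable hcI hz) hcz
  · have h1 : HasFDerivAt (fun x : ℝ × ℝ ↦ (p n).eval x.1)
        ((derivative (p n)).eval x.1 • ContinuousLinearMap.fst ℝ ℝ ℝ) x :=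
      ((p n).hasDerivAt x.1).comp_hasFDerivAt x hasFDerivAt_fst
    have h2 : HasFDerivAt (fun x : ℝ × ℝ ↦ x.2 ^ n)
        ((n * x.2 ^ (n - 1)) • ContinuousLinearMap.snd ℝ ℝ ℝ) x :=
      (hasDerivAt_pow n x.2).comp_hasFDerivAt x hasFDerivAt_snd
    convert! h1.mul h2 using 1
    ext
    · simp; ring
    · simp
  · have hx1 := Ioo_subset_Icc_self hx.1
    have hx2 := (abs_lt.2 hx.2).le
    refine (norm_add_le _ _).trans (add_le_add ?_ ?_)
    · rw [norm_smul]
      exact (mul_le_of_le_one_right (norm_nonneg _) (ContinuousLinearMap.norm_fst_le ℝ ℝ ℝ)).trans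
        (hub _ hx1 _ hx2 n)
    · rw [norm_smul]
      exact (mul_le_of_le_one_right (norm_nonneg _) (ContinuousLinearMap.norm_snd_le ℝ ℝ ℝ)).trans
        (hvb _ hx1 _ hx2 n)

/-- Termwise differentiation in `z`, which unlike the joint statement includes `c = ±1`. -/
theorem SubexpBound.hasDerivAt_polySeries (hp : SubexpBound p) {c z : ℝ} (hc : c ∈ Icc (-1 : ℝ) 1)
    (hz : z ∈ Ioo (-1 : ℝ) 1) :
    HasDerivAt (polySeries p c) (polySeries (Superelliptic.zDeriv p) c z) z := by
  obtain ⟨R, hzR, hR1⟩ := exists_between (abs_lt.2 hz)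
  obtain ⟨u, hu, h⟩ := hp.exists_summable_bound_deriv ((abs_nonneg z).trans hzR.le) hR1
  rw [← (hp.hasSum_zDeriv hc hz).tsum_eq]
  exact hasDerivAt_tsum_of_isPreconnected hu isOpen_Ioo isPreconnected_Ioo
    (t := Ioo (-R) R) (y₀ := z) (g := fun n y ↦ (p n).eval c * y ^ n)
    (fun n y _ ↦ (hasDerivAt_pow n y).const_mul _)
    (fun n y hy ↦ h c hc y (abs_lt.2 hy).le n) (abs_lt.1 hzR)
    (hp.summable hc hz) (abs_lt.1 hzR)

theorem SubexpBound.iteratedDeriv_polySeries {c z : ℝ} (hc : c ∈ Icc (-1 : ℝ) 1)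
    (hz : z ∈ Ioo (-1 : ℝ) 1) (k : ℕ) (hp : SubexpBound p) :
    iteratedDeriv k (polySeries p c) z = polySeries (Superelliptic.zDeriv^[k] p) c z := by
  induction k generalizing p with
  | zero => simp
  | succ k ih =>
    rw [iteratedDeriv_succ', Function.iterate_succ_apply, ← ih hp.zDeriv]
    refine Filter.EventuallyEq.iteratedDeriv_eq k ?_
    filter_upwards [isOpen_Ioo.mem_nhds hz] with y hy
    exact (hp.hasDerivAt_polySeries hc hy).deriv

/-- Moderate sequences are closed under both partial derivatives, so differentiability implies
smoothness. -/
theorem Moderate.contDiffOn_polySeries (hp : Moderate p) :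
    ContDiffOn ℝ ∞ (fun x : ℝ × ℝ ↦ polySeries p x.1 x.2)
      (Ioo (-1 : ℝ) 1 ×ˢ Ioo (-1 : ℝ) 1) := by
  rw [contDiffOn_infty]
  intro k
  induction k generalizing p with
  | zero =>
    rw [Nat.cast_zero, contDiffOn_zero]
    exact fun x hx ↦ (hp.subexpBound.hasFDerivAt_polySeries hp.derivative.subexpBound hx.1
      hx.2).continuousAt.continuousWithinAt
  | succ k ih =>
    have hs : IsOpen (Ioo (-1 : ℝ) 1 ×ˢ Ioo (-1 : ℝ) 1) := isOpen_Ioo.prod isOpen_Ioo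
    have hd := fun x (hx : x ∈ Ioo (-1 : ℝ) 1 ×ˢ Ioo (-1 : ℝ) 1) ↦
      hp.subexpBound.hasFDerivAt_polySeries hp.derivative.subexpBound hx.1 hx.2
    rw [Nat.cast_add, Nat.cast_one, contDiffOn_succ_iff_fderiv_of_isOpen hs]
    refine ⟨fun x hx ↦ (hd x hx).differentiableAt.differentiableWithinAt, by simp, ?_⟩
    refine ContDiffOn.congr ?_ fun x hx ↦ (hd x hx).fderiv
    exact ((ih hp.derivative).smul contDiffOn_const).add ((ih hp.zDeriv).smul contDiffOn_const)

/-! ### Differential equations for the generating function -/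

variable {f : ℝ → ℝ → ℝ}

/-- On `(-1, 1) × (-1, 1)` the function `f` is the sum of the series with coefficients `p`, all of
whose `c`-derivatives converge. -/
structure Represents (f : ℝ → ℝ → ℝ) (p : ℕ → ℝ[X]) : Prop where
  moderate : Moderate p
  eq : ∀ c ∈ Ioo (-1 : ℝ) 1, ∀ z ∈ Ioo (-1 : ℝ) 1, f c z = polySeries p c z

namespace Represents

theorem hasSum (hf : Represents f p) {c z : ℝ} (hc : c ∈ Ioo (-1 : ℝ) 1)
    (hz : z ∈ Ioo (-1 : ℝ) 1) : HasSum (fun n ↦ (p n).eval c * z ^ n) (f c z) := by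
  rw [hf.eq c hc z hz]
  exact hf.moderate.subexpBound.hasSum (Ioo_subset_Icc_self hc) hz

theorem dc (hf : Represents f p) : Represents (dc f) fun n ↦ derivative (p n) where
  moderate := hf.moderate.derivative
  eq c hc z hz := by
    have h :=
      hf.moderate.subexpBound.hasFDerivAt_polySeries hf.moderate.derivative.subexpBound hc hz
    have h2 := h.comp_hasDerivAt c ((hasDerivAt_id c).prodMk (hasDerivAt_const c z))
    have e : (fun x ↦ f x z) =ᶠ[𝓝 c] fun x ↦ polySeries p x z := by
      filter_upwards [isOpen_Ioo.mem_nhds hc] with x hx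
      exact hf.eq x hx z hz
    rw [Superelliptic.dc, e.deriv_eq]
    simpa [Function.comp_def] using h2.deriv

theorem dv (hf : Represents f p) : Represents (dv f) fun n ↦ C (n : ℝ) * p n where
  moderate := hf.moderate.natCast_mul
  eq c hc z hz := by
    have hcI := Ioo_subset_Icc_self hc
    have e : (fun y ↦ f c y) =ᶠ[𝓝 z] polySeries p c := by
      filter_upwards [isOpen_Ioo.mem_nhds hz] with y hy
      exact hf.eq c hc y hy
    rw [Superelliptic.dv, e.deriv_eq, (hf.moderate.subexpBound.hasDerivAt_polySeries hcI hz).deriv]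
    have h := (hf.moderate.subexpBound.hasSum_zDeriv hcI hz).mul_left z
    rw [← h.tsum_eq, polySeries]
    congr 1; funext n
    rcases n with _ | n
    · simp
    · simp; ring

theorem opE (hf : Represents f p) : Represents (opE f) (coeffE p) where
  moderate := hf.moderate.derivative.X_mul.add hf.moderate
  eq c hc z hz := by
    have h := ((hf.dc.hasSum hc hz).mul_left c).add (hf.hasSum hc hz)
    rw [polySeries, Superelliptic.opE, ← h.tsum_eq]
    congr 1; funext n
    simp [coeffE]; ring

theorem opL (m : ℕ) (hf : Represents f p) : Represents (opL m f) (coeffL m p) where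
  moderate := by
    have h := hf.moderate
    have h2 := h.derivative.derivative
    have h3 := ((((((h2.const_mul 4).add (h2.X_mul.X_mul.const_mul (-4))).add
      (h.derivative.X_mul.const_mul (-12))).add h.natCast_mul.natCast_mul).add
      (h.natCast_mul.const_mul (2 * (2 / (m : ℝ) - 3)))).add (h.const_mul (-4)))
    convert! h3 using 2 with n
    simp only [coeffL, map_add, map_sub, map_mul, map_neg, map_pow, map_ofNat C 4, map_ofNat C 12]
    ring
  eq c hc z hz := by
    have h := ((((((hf.dc.dc.hasSum hc hz).mul_left (4 * (1 - c ^ 2))).sub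
      ((hf.dc.hasSum hc hz).mul_left (12 * c))).add (hf.dv.dv.hasSum hc hz)).add
      ((hf.dv.hasSum hc hz).mul_left (2 * (2 / (m : ℝ) - 3)))).sub ((hf.hasSum hc hz).mul_left 4))
    rw [polySeries, Superelliptic.opL, ← h.tsum_eq]
    congr 1; funext n
    simp [coeffL]; ring

end Represents

theorem represents_genFun2 {m : ℕ} (hm : m ≠ 0) : Represents (genFun2 m) (poly2 m) :=
  ⟨moderate_poly2 hm, fun _ _ _ _ ↦ rfl⟩

theorem genFun2_pde {m : ℕ} (hm : m ≠ 0) {c z : ℝ} (hc : c ∈ Ioo (-1 : ℝ) 1)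
    (hz : z ∈ Ioo (-1 : ℝ) 1) :
    (m : ℝ) ^ 2 * opL m (opL m (genFun2 m)) c z
      + (144 * (m : ℝ) ^ 2 - 256 * (m : ℝ)) * dc (dc (genFun2 m)) c z
      - 16 * (3 * (m : ℝ) - 2) ^ 2 * opE (opE (genFun2 m)) c z = 0 := by
  have hf := represents_genFun2 hm
  have h := ((((hf.opL m).opL m).hasSum hc hz).mul_left ((m : ℝ) ^ 2)).add
    ((hf.dc.dc.hasSum hc hz).mul_left (144 * (m : ℝ) ^ 2 - 256 * (m : ℝ))) |>.sub
    ((hf.opE.opE.hasSum hc hz).mul_left (16 * (3 * (m : ℝ) - 2) ^ 2))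
  refine h.unique ?_
  convert! hasSum_zero using 2 with n
  have h2 := congrArg (eval c) (poly2_fourth_order hm n)
  simp only [eval_add, eval_sub, eval_mul, eval_C, eval_zero] at h2
  linear_combination z ^ n * h2

/-- The first-order equation in `z`: the recursion summed over all indices. The inhomogeneous term
comes from the initial value at index two, which does not obey the recursion. -/
theorem genFun2_first_order {m : ℕ} (hm : m ≠ 0) {c z : ℝ} (hc : c ∈ Icc (-1 : ℝ) 1)
    (hz : z ∈ Ioo (-1 : ℝ) 1) :
    m * quartic c z * (z * polySeries (zDeriv (poly2 m)) c z) =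
      ((3 * m - 4) - 2 * c * (3 * m - 2) * z ^ 2 + 3 * m * z ^ 4) * genFun2 m c z
        + (4 - m) * z ^ 2 := by
  have hp := (moderate_poly2 hm).subexpBound
  have hP : HasSum (fun n ↦ (poly2 m n).eval c * z ^ n) (genFun2 m c z) := hp.hasSum hc hz
  have hD : HasSum (fun n : ℕ ↦ n * (poly2 m n).eval c * z ^ n)
      (z * polySeries (zDeriv (poly2 m)) c z) := by
    convert! (hp.hasSum_zDeriv hc hz).mul_left z using 2 with n
    rcases n with _ | n
    · simp
    · simp; ring
  set P := genFun2 m c z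
  set D := z * polySeries (zDeriv (poly2 m)) c z
  have hP2 := (hasSum_nat_add_iff' 2).2 hP
  have hD2 := (hasSum_nat_add_iff' 2).2 hD
  have hP4 := (hasSum_nat_add_iff' 4).2 hP
  have hD4 := (hasSum_nat_add_iff' 4).2 hD
  have e0 : poly2 m 0 = 0 := rfl
  have e1 : poly2 m 1 = 0 := rfl
  have e2 : poly2 m 2 = 1 := rfl
  have e3 : poly2 m 3 = 0 := rfl
  simp only [Finset.sum_range_succ, Finset.sum_range_zero, e0, e1, e2, e3, eval_zero, eval_one]
    at hP2 hD2 hP4 hD4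
  have h := ((hD4.mul_left (m : ℝ)).sub (hP4.mul_left (3 * (m : ℝ) - 4))).sub
    (((hD2.mul_left (m : ℝ)).sub (hP2.mul_left (3 * (m : ℝ) - 2))).mul_left (2 * c * z ^ 2)) |>.add
    (((hD.mul_left (m : ℝ)).sub (hP.mul_left (3 * (m : ℝ)))).mul_left (z ^ 4))
  have h0 := h.unique (by
    convert! hasSum_zero using 2 with n
    have h2 := congrArg (eval c) (poly2_recursion m n)
    simp only [eval_sub, eval_mul, eval_C, eval_X] at h2
    push_cast
    linear_combination z ^ (n + 4) * h2)
  norm_num at h0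
  rw [quartic]
  linear_combination h0

/-! ### The superelliptic integral -/

theorem quartic_pos {c z : ℝ} (hc : c ≤ 1) (hz : z ∈ Ioo (-1 : ℝ) 1) : 0 < quartic c z := by
  have h1 : z ^ 2 < 1 := by rw [sq_lt_one_iff_abs_lt_one]; exact abs_lt.2 hz
  have h2 : 0 ≤ (1 - c) * z ^ 2 := mul_nonneg (by linarith) (sq_nonneg z)
  rw [quartic]
  nlinarith [pow_pos (sub_pos.2 h1) 2]

theorem hasDerivAt_quartic (c z : ℝ) :
    HasDerivAt (quartic c) (-4 * c * z + 4 * z ^ 3) z := by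
  have h := (((hasDerivAt_pow 2 z).const_mul (2 * c)).const_sub 1).add (hasDerivAt_pow 4 z)
  convert! h using 1
  push_cast; ring

/-- The generating function divided by the solution `z ^ (3 - 4 / m) * quartic c z ^ (1 / m)` of the
homogeneous equation is a primitive of the superelliptic integrand. -/
theorem hasDerivAt_quotient {m : ℕ} (hm : m ≠ 0) {c z : ℝ} (hc : c ∈ Icc (-1 : ℝ) 1)
    (hz : z ∈ Ioo (0 : ℝ) 1) :
    HasDerivAt (fun w ↦ genFun2 m c w * (w ^ (4 / (m : ℝ) - 3) * quartic c w ^ (-(1 / (m : ℝ)))))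
      ((4 - (m : ℝ)) / ((m : ℝ) * z ^ (2 - 4 / (m : ℝ)) * quartic c z ^ (1 + 1 / (m : ℝ)))) z := by
  have hz' : z ∈ Ioo (-1 : ℝ) 1 := ⟨by linarith [hz.1], hz.2⟩
  have hm' : (m : ℝ) ≠ 0 := Nat.cast_ne_zero.2 hm
  have hQ := quartic_pos hc.2 hz'
  have hP : HasDerivAt (genFun2 m c) (polySeries (zDeriv (poly2 m)) c z) z :=
    (moderate_poly2 hm).subexpBound.hasDerivAt_polySeries hc hz'
  have h := hP.mul ((Real.hasDerivAt_rpow_const (p := 4 / (m : ℝ) - 3) (Or.inl hz.1.ne')).mul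
    ((hasDerivAt_quartic c z).rpow_const (p := -(1 / (m : ℝ))) (Or.inl hQ.ne')))
  convert! h using 1
  simp only [Pi.mul_apply]
  have ode := genFun2_first_order hm hc hz'
  set Q := quartic c z with hQdef
  set P := genFun2 m c z
  set D := polySeries (zDeriv (poly2 m)) c z
  have e1 : z ^ (2 - 4 / (m : ℝ)) = z⁻¹ * (z ^ (4 / (m : ℝ) - 3))⁻¹ := by
    rw [← Real.rpow_neg hz.1.le, ← Real.rpow_neg_one, ← Real.rpow_add hz.1]; congr 1; ring
  have e2 : Q ^ (1 + 1 / (m : ℝ)) = Q * (Q ^ (-(1 / (m : ℝ))))⁻¹ := by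
    rw [← Real.rpow_neg hQ.le, neg_neg, Real.rpow_add hQ, Real.rpow_one]
  have e3 : z ^ (4 / (m : ℝ) - 3 - 1) = z ^ (4 / (m : ℝ) - 3) * z⁻¹ := by
    rw [Real.rpow_sub_one hz.1.ne', div_eq_mul_inv]
  have e4 : Q ^ (-(1 / (m : ℝ)) - 1) = Q ^ (-(1 / (m : ℝ))) * Q⁻¹ := by
    rw [Real.rpow_sub_one hQ.ne', div_eq_mul_inv]
  rw [e1, e2, e3, e4]
  have hA : z ^ (4 / (m : ℝ) - 3) ≠ 0 := (Real.rpow_pos_of_pos hz.1 _).ne'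
  have hB : Q ^ (-(1 / (m : ℝ))) ≠ 0 := (Real.rpow_pos_of_pos hQ _).ne'
  have hz0 : z ≠ 0 := hz.1.ne'
  have hQ0 : Q ≠ 0 := hQ.ne'
  generalize z ^ (4 / (m : ℝ) - 3) = A at *
  generalize Q ^ (-(1 / (m : ℝ))) = B at *
  have hQ4 : Q = 1 - 2 * c * z ^ 2 + z ^ 4 := rfl
  clear_value Q P D
  field_simp
  linear_combination -ode + (3 * m - 4) * P * hQ4

theorem genFun2_eq_sq_mul {m : ℕ} (hm : m ≠ 0) {c z : ℝ} (hc : c ∈ Icc (-1 : ℝ) 1)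
    (hz : z ∈ Ioo (-1 : ℝ) 1) :
    genFun2 m c z = z ^ 2 * polySeries (fun n ↦ poly2 m (n + 2)) c z := by
  have hp := (moderate_poly2 hm).subexpBound
  have h1 := (hasSum_nat_add_iff' 2).2 (hp.hasSum hc hz)
  have h2 := (hp.shift.shift.hasSum hc hz).mul_left (z ^ 2)
  have h3 := h1.unique (by convert! h2 using 2 with n; ring)
  simp only [Finset.sum_range_succ, Finset.sum_range_zero, poly2, Polynomial.eval_zero, zero_mul,
    add_zero, sub_zero] at h3
  exact h3

/-- Near `0` the quotient is asymptotic to the singular term of the regularised integral. -/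
theorem tendsto_quotient_sub {m : ℕ} (hm : m ≠ 0) {c : ℝ} (hc : c ∈ Icc (-1 : ℝ) 1) :
    Tendsto (fun ε : ℝ ↦ ε ^ (4 / (m : ℝ) - 1) -
      genFun2 m c ε * (ε ^ (4 / (m : ℝ) - 3) * quartic c ε ^ (-(1 / (m : ℝ)))))
      (𝓝[>] 0) (𝓝 0) := by
  have hm' : (0 : ℝ) < m := by positivity
  have h0 : (0 : ℝ) ∈ Ioo (-1 : ℝ) 1 := by norm_num
  have hp := (moderate_poly2 hm).subexpBound
  have hQ0 : quartic c 0 = 1 := by simp [quartic]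
  obtain ⟨g', hg⟩ : ∃ g', HasDerivAt (fun w ↦ polySeries (fun n ↦ poly2 m (n + 2)) c w *
      quartic c w ^ (-(1 / (m : ℝ)))) g' 0 :=
    ⟨_, (hp.shift.shift.hasDerivAt_polySeries hc h0).mul
      ((hasDerivAt_quartic c 0).rpow_const (Or.inl (by rw [hQ0]; exact one_ne_zero)))⟩
  set G := fun w ↦ polySeries (fun n ↦ poly2 m (n + 2)) c w * quartic c w ^ (-(1 / (m : ℝ))) with hG
  have hG0 : G 0 = 1 := by simp [hG, hQ0, poly2]
  have hslope := (hasDerivAt_iff_tendsto_slope.1 hg).mono_left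
    (nhdsWithin_mono 0 (fun x (hx : 0 < x) ↦ hx.ne'))
  have hpow : Tendsto (fun ε : ℝ ↦ ε ^ (4 / (m : ℝ))) (𝓝[>] 0) (𝓝 0) := by
    have h := (Real.continuousAt_rpow_const (0 : ℝ) (4 / (m : ℝ)) (Or.inr (by positivity))).tendsto
    rw [Real.zero_rpow (by positivity)] at h
    exact h.mono_left nhdsWithin_le_nhds
  have hmul := (hpow.mul hslope).neg
  rw [zero_mul, neg_zero] at hmul
  refine hmul.congr' ?_
  filter_upwards [Ioo_mem_nhdsGT (zero_lt_one' ℝ)] with ε hε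
  have e1 : ε ^ (4 / (m : ℝ) - 1) = ε ^ (4 / (m : ℝ)) * ε⁻¹ := by
    rw [Real.rpow_sub_one hε.1.ne', div_eq_mul_inv]
  have e2 : ε ^ (4 / (m : ℝ) - 3) * ε ^ 2 = ε ^ (4 / (m : ℝ)) * ε⁻¹ := by
    rw [← e1, ← Real.rpow_natCast, ← Real.rpow_add hε.1]; congr 1; push_cast; ring
  rw [slope_def_field, hG0, sub_zero, genFun2_eq_sq_mul hm hc ⟨by linarith [hε.1], hε.2⟩, e1]
  simp only [hG]
  linear_combination
    (polySeries (fun n ↦ poly2 m (n + 2)) c ε * quartic c ε ^ (-(1 / (m : ℝ)))) * e2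

theorem tendsto_regIntegral2 {m : ℕ} (hm : m ≠ 0) {c z : ℝ} (hc : c ∈ Icc (-1 : ℝ) 1)
    (hz : z ∈ Ioo (0 : ℝ) 1) :
    Tendsto (fun ε : ℝ ↦ regIntegral2 m c z ε) (𝓝[>] 0)
      (𝓝 (genFun2 m c z * (z ^ (4 / (m : ℝ) - 3) * quartic c z ^ (-(1 / (m : ℝ)))))) := by
  have h := (tendsto_quotient_sub hm hc).const_add
    (genFun2 m c z * (z ^ (4 / (m : ℝ) - 3) * quartic c z ^ (-(1 / (m : ℝ)))))
  rw [add_zero] at h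
  refine h.congr' ?_
  filter_upwards [Ioo_mem_nhdsGT hz.1] with ε hε
  have hsub : uIcc ε z ⊆ Ioo 0 1 := by
    rw [uIcc_of_le hε.2.le]
    exact fun w hw ↦ ⟨hε.1.trans_le hw.1, hw.2.trans_lt hz.2⟩
  have hm' : (0 : ℝ) < m := by positivity
  have hcont : ContinuousOn (fun w : ℝ ↦ (4 - (m : ℝ)) /
      ((m : ℝ) * w ^ (2 - 4 / (m : ℝ)) * quartic c w ^ (1 + 1 / (m : ℝ)))) (uIcc ε z) := by
    intro w hw
    have hw' := hsub hw
    have hQ := quartic_pos hc.2 (⟨by linarith [hw'.1], hw'.2⟩ : w ∈ Ioo (-1 : ℝ) 1)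
    refine ContinuousAt.continuousWithinAt (continuousAt_const.div ((continuousAt_const.mul
      (Real.continuousAt_rpow_const _ _ (Or.inl hw'.1.ne'))).mul
      ((hasDerivAt_quartic c w).continuousAt.rpow_const (Or.inl hQ.ne'))) ?_)
    have := Real.rpow_pos_of_pos hw'.1 (2 - 4 / (m : ℝ))
    have := Real.rpow_pos_of_pos hQ (1 + 1 / (m : ℝ))
    positivity
  rw [regIntegral2, intervalIntegral.integral_eq_sub_of_hasDerivAt
    (fun w hw ↦ hasDerivAt_quotient hm hc (hsub hw)) hcont.intervalIntegrable]
  ring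

end Superelliptic

theorem mainTheorem4 (m : ℕ) (hm : 2 ≤ m) :
    -- the generating series converges
    (∀ c ∈ Icc (-1 : ℝ) 1, ∀ z ∈ Ioo (-1 : ℝ) 1,
      Summable fun n : ℕ => (Superelliptic.poly2 m n).eval c * z ^ n) ∧
    -- its sum is a superelliptic integral
    (∀ c ∈ Icc (-1 : ℝ) 1, ∀ z ∈ Ioo (0 : ℝ) 1, ∃ I : ℝ,
      Tendsto (fun ε : ℝ => Superelliptic.regIntegral2 m c z ε) (𝓝[>] 0) (𝓝 I) ∧
      Superelliptic.genFun2 m c z =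
        z ^ (3 - 4 / (m : ℝ)) * Superelliptic.quartic c z ^ (1 / (m : ℝ)) * I) ∧
    -- it is smooth, so that the partial derivatives below are genuine
    ContDiffOn ℝ ∞ (fun p : ℝ × ℝ => Superelliptic.genFun2 m p.1 p.2)
      (Ioo (-1 : ℝ) 1 ×ˢ Ioo (-1 : ℝ) 1) ∧
    -- the partial differential equation
    (∀ c ∈ Ioo (-1 : ℝ) 1, ∀ z ∈ Ioo (0 : ℝ) 1,
      (m : ℝ) ^ 2 *
          Superelliptic.opL m (Superelliptic.opL m (Superelliptic.genFun2 m)) c z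
        + (144 * (m : ℝ) ^ 2 - 256 * (m : ℝ)) *
          Superelliptic.dc (Superelliptic.dc (Superelliptic.genFun2 m)) c z
        - 16 * (3 * (m : ℝ) - 2) ^ 2 *
          Superelliptic.opE (Superelliptic.opE (Superelliptic.genFun2 m)) c z = 0) ∧
    -- the boundary conditions at `z = 0`
    (∀ c ∈ Icc (-1 : ℝ) 1,
      iteratedDeriv 2 (fun z => Superelliptic.genFun2 m c z) 0 = 2 ∧
      Superelliptic.genFun2 m c 0 = 0 ∧
      deriv (fun z => Superelliptic.genFun2 m c z) 0 = 0 ∧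
      iteratedDeriv 3 (fun z => Superelliptic.genFun2 m c z) 0 = 0) := by
  have hm0 : m ≠ 0 := by omega
  have hp := (Superelliptic.moderate_poly2 hm0).subexpBound
  refine ⟨fun c hc z hz ↦ hp.summable hc hz, fun c hc z hz ↦
    ⟨_, Superelliptic.tendsto_regIntegral2 hm0 hc hz, ?_⟩,
    (Superelliptic.moderate_poly2 hm0).contDiffOn_polySeries,
    fun c hc z hz ↦ Superelliptic.genFun2_pde hm0 hc ⟨by linarith [hz.1], hz.2⟩, fun c hc ↦ ?_⟩
  · have hQ := Superelliptic.quartic_pos hc.2 (⟨by linarith [hz.1], hz.2⟩ : z ∈ Ioo (-1 : ℝ) 1)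
    have e1 : z ^ (3 - 4 / (m : ℝ)) * z ^ (4 / (m : ℝ) - 3) = 1 := by
      rw [← Real.rpow_add hz.1, sub_add_sub_cancel, sub_self, Real.rpow_zero]
    have e2 : Superelliptic.quartic c z ^ (1 / (m : ℝ)) *
        Superelliptic.quartic c z ^ (-(1 / (m : ℝ))) = 1 := by
      rw [← Real.rpow_add hQ, add_neg_cancel, Real.rpow_zero]
    calc Superelliptic.genFun2 m c z = Superelliptic.genFun2 m c z *
          (z ^ (3 - 4 / (m : ℝ)) * z ^ (4 / (m : ℝ) - 3)) *
          (Superelliptic.quartic c z ^ (1 / (m : ℝ)) *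
            Superelliptic.quartic c z ^ (-(1 / (m : ℝ)))) := by rw [e1, e2, mul_one, mul_one]
      _ = _ := by ring
  · have h0 : (0 : ℝ) ∈ Ioo (-1 : ℝ) 1 := by norm_num
    have key := fun k ↦ hp.iteratedDeriv_polySeries hc h0 k
    change iteratedDeriv 2 (Superelliptic.polySeries (Superelliptic.poly2 m) c) 0 = 2 ∧
      Superelliptic.polySeries (Superelliptic.poly2 m) c 0 = 0 ∧
      deriv (Superelliptic.polySeries (Superelliptic.poly2 m) c) 0 = 0 ∧
      iteratedDeriv 3 (Superelliptic.polySeries (Superelliptic.poly2 m) c) 0 = 0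
    rw [← iteratedDeriv_one, key 1, key 2, key 3]
    simp [Superelliptic.zDeriv, Superelliptic.poly2]
    norm_num
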